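/- Let $H$ be a complex Hilbert space (not necessarily separable) with $\dim H\ge 3$, finite or infinite. Let $E(H)$ be its effect algebra, that is, the set of all bounded self-adjoint operators $A$ on $H$ with $0\le A\le I$, where $\le$ is the Loewner order ($A\le B$ if and only if $\langle (B-A)x,x\rangle\ge 0$ for all $x\in H$). Let $\phi:E(H)\to E(H)$ be a bijective map such that $$A\le B\iff \phi(A)\le\phi(B)\qquad (A,B\in E(H))$$ and $$\phi(I-A)=I-\phi(A)\qquad (A\in E(H)).$$ Then there exists a unitary or antiunitary operator $U:H\to H$ such that $$\phi(A)=UAU^*\qquad\text{for every } A\in E(H).$$ Here an antiunitary operator is a bijective conjugate-linear map $U:H\to H$ with $\langle Ux,Uy\rangle=\langle y,x\rangle$ for all $x,y\in H$, and the adjoint $U^*$ of a bounded conjugate-linear operator $U$ is the bounded conjugate-linear operator determined by $\langle Ux,y\rangle=\langle U^*y,x\rangle$ for all $x,y\in H$. -/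

import Mathlib

namespace EffectAlgebra

/-- The effect algebra of `H`: the self-adjoint bounded operators `A` with `0 ≤ A` and `0 ≤ I - A`,
where `≤` is the Loewner order (Mathlib's order on `H →L[ℂ] H`). -/
def effects (H : Type*) [NormedAddCommGroup H] [InnerProductSpace ℂ H] [CompleteSpace H] :
    Set (H →L[ℂ] H) :=
  {A | IsSelfAdjoint A ∧ 0 ≤ A ∧ 0 ≤ 1 - A}

/-- The orthocomplement `I - A` of an effect `A`. -/
def orthocomplement {H : Type*} [NormedAddCommGroup H] [InnerProductSpace ℂ H] [CompleteSpace H]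
    (A : effects H) : effects H :=
  ⟨1 - A.1, (IsSelfAdjoint.one (H →L[ℂ] H)).sub A.2.1, A.2.2.2, by
    rw [sub_sub_cancel]
    exact A.2.2.1⟩

/-- The adjoint of a bounded conjugate-linear operator `T`: the vector `T* y` is the Riesz
representative of the bounded linear functional `x ↦ ⟪T x, y⟫` (the inner product being
conjugate-linear in its first argument). -/
noncomputable def conjAdjoint {H : Type*} [NormedAddCommGroup H] [InnerProductSpace ℂ H]
    [CompleteSpace H] (T : H →L⋆[ℂ] H) : H →L⋆[ℂ] H :=
  ((InnerProductSpace.toDual ℂ H).symm.toContinuousLinearEquiv :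
      StrongDual ℂ H →L⋆[ℂ] H).comp
    ((ContinuousLinearMap.compSL H H ℂ (starRingEnd ℂ) (starRingEnd ℂ)).flip T ∘L
      (innerSL ℂ (E := H)).flip)

/-- The identity that characterizes the adjoint of a bounded conjugate-linear operator. -/
theorem inner_conjAdjoint_left {H : Type*} [NormedAddCommGroup H] [InnerProductSpace ℂ H]
    [CompleteSpace H] (T : H →L⋆[ℂ] H) (x y : H) :
    inner ℂ (conjAdjoint T y) x = inner ℂ (T x) y := by
  simp [conjAdjoint]

/-- A bounded conjugate-linear operator `U` on `H` is antiunitary if it is bijective and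
`⟪U x, U y⟫ = ⟪y, x⟫` for all `x`, `y`. -/
def IsAntiunitary {H : Type*} [NormedAddCommGroup H] [InnerProductSpace ℂ H]
    (U : H →L⋆[ℂ] H) : Prop :=
  Function.Bijective U ∧ ∀ x y : H, inner ℂ (U x) (U y) = inner ℂ y x

end EffectAlgebra

/-!
An ortho-order automorphism `e` of the effect algebra is studied through the *weak atoms*, the
effects `t P` with `P` a rank-one projection and `t ∈ [0, 1]`. They are the effects whose lower set
is a chain, and the maximal ones are the rank-one projections, so `e` acts on unit vectors (up to
phase) by a map `T`, and on the multiples of the projection to the line of `x` by an order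
automorphism `h x` of `[0, 1]` (`exists_map_weakAtom`).

The numbers `h x` and the map `T` are tied together by strengths: the strength of an effect `A`
along `y` is the largest `t` such that `t` times the projection to the line of `y` is below `A`, and
it equals `1 / ⟪A w, w⟫` if `A w = y` (`weakAtom_le_iff`). Compatibility with complements gives
`h x (1 - t) = 1 - h x t`, hence `h x (1/2) = 1/2`, and `e` maps `1 - P / 2` to an effect of the same
form. The strength of `1 - P / 2` along `y` is `1 / (1 + c)`, where `c = |⟪x, y⟫|²` is the
transition probability between `y` and the line of `P`. Comparing strengths, `|⟪T x, T y⟫|²` is the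
image of `c` under a function `f` that depends only on `y` and is computed from `h y`
(`norm_inner_map_sq`). In particular orthogonality is preserved, so the transition probabilities of
a vector to an orthonormal triple spanning it still have sum `1`. Therefore `f a + g b + k c = 1`
whenever `a + b + c = 1`, where `f`, `g`, `k` are the functions of the triple. These functions are
nonnegative and vanish at `0`, so they are the identity (`transitionMap_eq_self`). Consequently `T`
preserves transition probabilities and every `h x` is the identity.

By Wigner's theorem, proved in `exists_phase_of_norm_inner_map`, `T` is induced up to phases by a
unitary or antiunitary `U`. Finally, an effect is determined by the weak atoms below it
(`exists_weakAtom_le`), so `e` is conjugation by `U` on all effects (`quadForm_map_eq`).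
-/

namespace EffectAlgebra

open ContinuousLinearMap InnerProductSpace unitInterval

local notation "⟪" x ", " y "⟫" => inner ℂ x y

theorem inner_sphere_self {H : Type*} [NormedAddCommGroup H] [InnerProductSpace ℂ H]
    (x : Metric.sphere (0 : H) 1) : ⟪x.1, x.1⟫ = 1 := by
  simp [inner_self_eq_norm_sq_to_K]

section Order

variable {H : Type*} [NormedAddCommGroup H] [InnerProductSpace ℂ H] [CompleteSpace H]

/-! ### The Loewner order through quadratic forms -/

/-- The real quadratic form `z ↦ ⟪A z, z⟫` of an effect `A`. -/
noncomputable def quadForm (A : effects H) (z : H) : ℝ := A.1.reApplyInnerSelf z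

theorem isPositive_coe (A : effects H) : A.1.IsPositive :=
  (nonneg_iff_isPositive _).1 A.2.2.1

theorem inner_apply_right (A : effects H) (x y : H) : ⟪x, A.1 y⟫ = ⟪A.1 x, y⟫ :=
  ((isPositive_coe A).inner_left_eq_inner_right x y).symm

theorem inner_apply_self (A : effects H) (z : H) : ⟪A.1 z, z⟫ = (quadForm A z : ℂ) :=
  ((isPositive_coe A).isSymmetric.coe_reApplyInnerSelf_apply z).symm

theorem quadForm_nonneg (A : effects H) (z : H) : 0 ≤ quadForm A z := (isPositive_coe A).2 z

theorem le_iff_quadForm {A B : effects H} : A ≤ B ↔ ∀ z, quadForm A z ≤ quadForm B z := by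
  have hs : IsSelfAdjoint (B.1 - A.1) := B.2.1.sub A.2.1
  rw [← Subtype.coe_le_coe, ContinuousLinearMap.le_def, isPositive_def']
  simp [hs, quadForm, reApplyInnerSelf_apply, inner_sub_left]

theorem quadForm_injective {A B : effects H} (h : ∀ z, quadForm A z = quadForm B z) : A = B :=
  le_antisymm (le_iff_quadForm.2 fun z => (h z).le) (le_iff_quadForm.2 fun z => (h z).ge)

theorem quadForm_orthocomplement (A : effects H) (z : H) :
    quadForm (orthocomplement A) z = ‖z‖ ^ 2 - quadForm A z := by
  simp [quadForm, orthocomplement, reApplyInnerSelf_apply, inner_sub_left,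
    inner_self_eq_norm_sq_to_K, ← Complex.ofReal_pow]

theorem quadForm_le (A : effects H) (z : H) : quadForm A z ≤ ‖z‖ ^ 2 := by
  have := quadForm_nonneg (orthocomplement A) z
  rw [quadForm_orthocomplement] at this
  linarith

/-- The Cauchy–Schwarz inequality for the semi-inner product `⟪A w, z⟫`. -/
theorem norm_inner_apply_sq_le (A : effects H) (w z : H) :
    ‖⟪A.1 w, z⟫‖ ^ 2 ≤ quadForm A w * quadForm A z := by
  obtain ⟨S, hS⟩ := CStarAlgebra.nonneg_iff_eq_star_mul_self.1 A.2.2.1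
  have key : ∀ u v, ⟪A.1 u, v⟫ = ⟪S u, S v⟫ := fun u v => by
    rw [hS, mul_apply_eq_comp, star_eq_adjoint, adjoint_inner_left]
  have hq : ∀ u, quadForm A u = ‖S u‖ ^ 2 := fun u => by
    have := inner_apply_self A u
    rw [key, inner_self_eq_norm_sq_to_K] at this
    exact Complex.ofReal_injective (by rw [← this]; push_cast; rfl)
  rw [key, hq, hq, ← mul_pow]
  gcongr
  exact norm_inner_le_norm _ _

theorem apply_eq_zero_of_quadForm_eq_zero {A : effects H} {z : H} (h : quadForm A z = 0) :
    A.1 z = 0 := by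
  have := norm_inner_apply_sq_le A z (A.1 z)
  rw [h, zero_mul] at this
  exact inner_self_eq_zero.1 (norm_eq_zero.1 (pow_eq_zero_iff two_ne_zero |>.1
    (le_antisymm this (by positivity))))

/-! ### Weak atoms -/

/-- The weak atom `t P`, where `P` is the orthogonal projection onto the line spanned by the unit
vector `x` and `t ∈ [0, 1]`. -/
noncomputable def weakAtom (t : I) (x : Metric.sphere (0 : H) 1) : effects H :=
  ⟨((t : ℝ) : ℂ) • rankOne ℂ x.1 x.1, by
    have hp : (((t : ℝ) : ℂ) • rankOne ℂ x.1 x.1).IsPositive :=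
      (isPositive_rankOne_self x.1).smul_of_nonneg (by exact_mod_cast t.2.1)
    refine ⟨hp.isSelfAdjoint, (nonneg_iff_isPositive _).2 hp, ?_⟩
    rw [nonneg_iff_isPositive, isPositive_def']
    refine ⟨(IsSelfAdjoint.one _).sub hp.isSelfAdjoint, fun z => ?_⟩
    have h1 : ‖⟪x.1, z⟫‖ ^ 2 ≤ ‖z‖ ^ 2 := by
      have := norm_inner_le_norm (𝕜 := ℂ) x.1 z
      rw [norm_eq_of_mem_sphere x, one_mul] at this
      gcongr
    have h2 : (t : ℝ) * ‖⟪x.1, z⟫‖ ^ 2 ≤ ‖⟪x.1, z⟫‖ ^ 2 :=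
      mul_le_of_le_one_left (by positivity) t.2.2
    simp only [reApplyInnerSelf_apply, sub_apply, one_apply_eq_self,
      smul_apply, rankOne_apply, inner_sub_left, inner_smul_left,
      inner_self_eq_norm_sq_to_K, Complex.conj_ofReal, Complex.conj_mul', map_sub]
    norm_cast
    simp only [RCLike.re_to_complex, Complex.ofReal_re]
    norm_cast
    linarith⟩

theorem weakAtom_apply (t : I) (x : Metric.sphere (0 : H) 1) (z : H) :
    (weakAtom t x).1 z = ((t : ℝ) * ⟪x.1, z⟫ : ℂ) • x.1 := by
  rw [mul_smul]
  rfl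

theorem quadForm_weakAtom (t : I) (x : Metric.sphere (0 : H) 1) (z : H) :
    quadForm (weakAtom t x) z = t * ‖⟪x.1, z⟫‖ ^ 2 := by
  have h := inner_apply_self (weakAtom t x) z
  rw [weakAtom_apply, inner_smul_left, map_mul, Complex.conj_ofReal, mul_assoc,
    Complex.conj_mul'] at h
  exact_mod_cast h.symm

theorem weakAtom_le_weakAtom {s t : I} {x : Metric.sphere (0 : H) 1} :
    weakAtom s x ≤ weakAtom t x ↔ s ≤ t := by
  rw [le_iff_quadForm, ← Subtype.coe_le_coe]
  simp only [quadForm_weakAtom]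
  refine ⟨fun h => ?_, fun h z => by gcongr⟩
  simpa [inner_sphere_self] using h x

theorem weakAtom_inj {s t : I} {x : Metric.sphere (0 : H) 1} :
    weakAtom s x = weakAtom t x ↔ s = t := by
  refine ⟨fun h => le_antisymm ?_ ?_, fun h => h ▸ rfl⟩
  · exact weakAtom_le_weakAtom.1 h.le
  · exact weakAtom_le_weakAtom.1 h.ge

/-- The effects below a weak atom `t P` are the weak atoms `s P` with `s ≤ t`. -/
theorem exists_eq_weakAtom_of_le {B : effects H} {t : I} {x : Metric.sphere (0 : H) 1}
    (h : B ≤ weakAtom t x) : ∃ s ≤ t, B = weakAtom s x := by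
  have hs : quadForm B x ∈ I := ⟨quadForm_nonneg _ _, by simpa using quadForm_le B x⟩
  have hker : ∀ z, ⟪x.1, z⟫ = 0 → B.1 z = 0 := fun z hz => by
    refine apply_eq_zero_of_quadForm_eq_zero (le_antisymm ?_ (quadForm_nonneg _ _))
    simpa [quadForm_weakAtom, hz] using le_iff_quadForm.1 h z
  have hB : B = weakAtom ⟨_, hs⟩ x := by
    refine quadForm_injective fun z => ?_
    have h1 : B.1 (z - ⟪x.1, z⟫ • x.1) = 0 := hker _ (by
      rw [inner_sub_right, inner_smul_right, inner_sphere_self, mul_one, sub_self])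
    rw [map_sub, map_smul, sub_eq_zero] at h1
    have h2 : ⟪x.1, B.1 z⟫ = ⟪x.1, z⟫ * quadForm B x := by
      rw [h1, inner_smul_right, inner_apply_right, inner_apply_self]
    have h3 : (quadForm B z : ℂ) = quadForm B x * ‖⟪x.1, z⟫‖ ^ 2 := by
      rw [← inner_apply_self, h1, inner_smul_left, ← inner_apply_right, h2,
        ← Complex.conj_mul']
      ring
    rw [quadForm_weakAtom]
    exact_mod_cast h3
  exact ⟨_, weakAtom_le_weakAtom.1 (hB ▸ h), hB⟩

/-- Two unit vectors span the same line if a nonzero weak atom of one is below a weak atom of the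
other. -/
theorem eq_smul_of_weakAtom_le {s t : I} {x y : Metric.sphere (0 : H) 1} (hs : s ≠ 0)
    (h : weakAtom s x ≤ weakAtom t y) : ∃ c : ℂ, ‖c‖ = 1 ∧ x.1 = c • y.1 := by
  obtain ⟨u, -, hu⟩ := exists_eq_weakAtom_of_le h
  have h1 := weakAtom_apply u y x.1
  rw [← hu, weakAtom_apply, inner_sphere_self, mul_one] at h1
  have hs' : ((s : ℝ) : ℂ) ≠ 0 := by simpa using hs
  have h2 : x.1 = ((((s : ℝ) : ℂ))⁻¹ * ((u : ℝ) * ⟪y.1, x.1⟫)) • y.1 := by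
    rw [mul_smul, ← h1, inv_smul_smul₀ hs']
  refine ⟨_, ?_, h2⟩
  have h3 := congrArg norm h2
  rw [norm_smul, norm_eq_of_mem_sphere, norm_eq_of_mem_sphere, mul_one] at h3
  exact h3.symm

theorem weakAtom_eq_of_eq_smul {t : I} {x y : Metric.sphere (0 : H) 1} {c : ℂ} (hc : ‖c‖ = 1)
    (h : x.1 = c • y.1) : weakAtom t x = weakAtom t y := by
  refine quadForm_injective fun z => ?_
  rw [quadForm_weakAtom, quadForm_weakAtom, h, inner_smul_left, norm_mul, RCLike.norm_conj, hc,
    one_mul]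

/-- The strength of an effect along a vector in its range: if `A w = x` then the weak atoms
`t P` below `A` are those with `t ⟪A w, w⟫ ≤ 1`. -/
theorem weakAtom_le_iff {A : effects H} {t : I} {x : Metric.sphere (0 : H) 1} {w : H}
    (hw : A.1 w = x) : weakAtom t x ≤ A ↔ t * quadForm A w ≤ 1 := by
  simp only [le_iff_quadForm, quadForm_weakAtom, ← hw]
  refine ⟨fun h => ?_, fun h z => ?_⟩
  · have hq : 0 < quadForm A w := by
      refine (quadForm_nonneg A w).lt_of_ne fun h0 => ?_
      rw [apply_eq_zero_of_quadForm_eq_zero h0.symm] at hw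
      have := norm_eq_of_mem_sphere x
      simp [← hw] at this
    have := h w
    rw [inner_apply_self, Complex.norm_real, Real.norm_of_nonneg hq.le, sq, ← mul_assoc] at this
    exact le_of_mul_le_mul_right (by rwa [one_mul]) hq
  · calc (t : ℝ) * ‖⟪A.1 w, z⟫‖ ^ 2 ≤ t * (quadForm A w * quadForm A z) := by
          gcongr
          · exact t.2.1
          · exact norm_inner_apply_sq_le A w z
      _ ≤ 1 * quadForm A z := by
          rw [← mul_assoc]
          exact mul_le_mul_of_nonneg_right h (quadForm_nonneg A z)
      _ = _ := one_mul _

/-- An effect dominates a weak atom that has the same quadratic form at a given vector `w`, namely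
`|A w⟩⟨A w| / ⟪A w, w⟫`; hence its quadratic form is the pointwise supremum of those of the weak
atoms below it. -/
theorem exists_weakAtom_le {A : effects H} {w : H} (hw : A.1 w ≠ 0) :
    ∃ (t : I) (x : Metric.sphere (0 : H) 1), x.1 = ((‖A.1 w‖⁻¹ : ℝ) : ℂ) • A.1 w ∧
      weakAtom t x ≤ A ∧ quadForm (weakAtom t x) w = quadForm A w := by
  have hn : 0 < ‖A.1 w‖ := norm_pos_iff.2 hw
  have hq : 0 < quadForm A w := (quadForm_nonneg A w).lt_of_ne fun h0 =>
    hw (apply_eq_zero_of_quadForm_eq_zero h0.symm)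
  let x : Metric.sphere (0 : H) 1 := ⟨((‖A.1 w‖⁻¹ : ℝ) : ℂ) • A.1 w, by
    rw [mem_sphere_zero_iff_norm, norm_smul, Complex.norm_real, norm_inv, norm_norm,
      inv_mul_cancel₀ hn.ne']⟩
  have hx : A.1 (((‖A.1 w‖⁻¹ : ℝ) : ℂ) • w) = x := map_smul _ _ _
  have hqx : quadForm A (((‖A.1 w‖⁻¹ : ℝ) : ℂ) • w) = quadForm A w / ‖A.1 w‖ ^ 2 := by
    rw [quadForm, reApplyInnerSelf_smul, ← quadForm, Complex.norm_real, norm_inv, norm_norm]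
    field_simp
  -- `‖A w‖² ≤ ⟪A w, w⟫` because `A ≤ 1`.
  have hle : ‖A.1 w‖ ^ 2 ≤ quadForm A w := by
    have h1 := norm_inner_apply_sq_le A w (A.1 w)
    have h2 := quadForm_le A (A.1 w)
    have h3 : ‖⟪A.1 w, A.1 w⟫‖ = ‖A.1 w‖ ^ 2 := by
      rw [inner_self_eq_norm_sq_to_K]
      simp
    rw [h3] at h1
    have h4 : ‖A.1 w‖ ^ 2 * ‖A.1 w‖ ^ 2 ≤ quadForm A w * ‖A.1 w‖ ^ 2 := by
      nlinarith
    exact le_of_mul_le_mul_right h4 (by positivity)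
  have hleA : weakAtom ⟨‖A.1 w‖ ^ 2 / quadForm A w, by positivity, by
      rwa [div_le_one hq]⟩ x ≤ A := by
    rw [weakAtom_le_iff hx, hqx]
    apply le_of_eq
    field_simp
  refine ⟨_, x, rfl, hleA, ?_⟩
  rw [quadForm_weakAtom]
  simp only [x]
  rw [inner_smul_left, inner_apply_self, norm_mul, RCLike.norm_conj, Complex.norm_real,
    Complex.norm_real, norm_inv, norm_norm, Real.norm_of_nonneg hq.le]
  field_simp

theorem isChain_Iic_weakAtom (t : I) (x : Metric.sphere (0 : H) 1) :
    IsChain (· ≤ ·) (Set.Iic (weakAtom t x)) := by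
  intro B hB C hC _
  obtain ⟨s, -, rfl⟩ := exists_eq_weakAtom_of_le hB
  obtain ⟨u, -, rfl⟩ := exists_eq_weakAtom_of_le hC
  simpa only [weakAtom_le_weakAtom] using le_total s u

/-- Weak atoms are characterized by the order: they are the effects whose lower set is a chain. -/
theorem exists_eq_weakAtom_of_isChain [Nontrivial H] {A : effects H}
    (h : IsChain (· ≤ ·) (Set.Iic A)) : ∃ t x, A = weakAtom t x := by
  by_cases hA : ∀ z, A.1 z = 0
  · obtain ⟨x, hx⟩ := NormedSpace.sphere_nonempty (E := H) (x := 0) (r := 1) |>.2 zero_le_one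
    exact ⟨0, ⟨x, hx⟩, quadForm_injective fun z => by
      rw [quadForm_weakAtom]
      simp [quadForm, reApplyInnerSelf_apply, hA]⟩
  push Not at hA
  obtain ⟨w, hw⟩ := hA
  obtain ⟨t, x, hx, hxA, hqx⟩ := exists_weakAtom_le hw
  have hq : ∀ {z}, A.1 z ≠ 0 → quadForm A z ≠ 0 := fun hz h0 =>
    hz (apply_eq_zero_of_quadForm_eq_zero h0)
  have ht : t ≠ 0 := by
    rintro rfl
    exact hq hw (by rw [← hqx]; simp [quadForm_weakAtom])
  -- Every value of `A` lies on the line of `x`, since the weak atoms below `A` are comparable.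
  have hrange : ∀ z, ∃ c : ℂ, A.1 z = c • x.1 := fun z => by
    by_cases hz : A.1 z = 0
    · exact ⟨0, by simp [hz]⟩
    obtain ⟨s, y, hy, hyA, hqy⟩ := exists_weakAtom_le hz
    have hs : s ≠ 0 := by
      rintro rfl
      exact hq hz (by rw [← hqy]; simp [quadForm_weakAtom])
    have hn : ((‖A.1 z‖ : ℝ) : ℂ) ≠ 0 := by simpa using hz
    have hz' : A.1 z = ((‖A.1 z‖ : ℝ) : ℂ) • y.1 := by
      rw [hy, smul_smul, Complex.ofReal_inv, mul_inv_cancel₀ hn, one_smul]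
    rcases h.total hyA hxA with hle | hle
    · obtain ⟨c, -, hc⟩ := eq_smul_of_weakAtom_le hs hle
      exact ⟨‖A.1 z‖ * c, by rw [mul_smul, ← hc, ← hz']⟩
    · obtain ⟨c, hc1, hc⟩ := eq_smul_of_weakAtom_le ht hle
      have hc0 : c ≠ 0 := by
        rintro rfl
        simp at hc1
      exact ⟨‖A.1 z‖ * c⁻¹, by rw [mul_smul, hc, inv_smul_smul₀ hc0, ← hz']⟩
  have hA1 : A ≤ weakAtom 1 x := by
    rw [le_iff_quadForm]
    intro z
    obtain ⟨c, hc⟩ := hrange z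
    have h1 : ⟪A.1 z, x.1⟫ = (starRingEnd ℂ) c := by
      rw [hc, inner_smul_left, inner_sphere_self, mul_one]
    have h2 : quadForm A z = ‖c‖ * ‖⟪x.1, z⟫‖ := by
      have := congrArg norm (inner_apply_self A z)
      rw [hc, inner_smul_left, norm_mul, RCLike.norm_conj, Complex.norm_real,
        Real.norm_of_nonneg (quadForm_nonneg A z)] at this
      exact this.symm
    have h3 := norm_inner_apply_sq_le A z x
    have h4 : quadForm A x ≤ 1 := by simpa using quadForm_le A x
    rw [h1, RCLike.norm_conj] at h3
    have h5 : ‖c‖ ^ 2 ≤ quadForm A z :=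
      h3.trans (mul_le_of_le_one_right (quadForm_nonneg A z) h4)
    rw [quadForm_weakAtom, h2, Set.Icc.coe_one, one_mul]
    rw [h2] at h5
    rcases (norm_nonneg c).eq_or_lt with h0 | h0
    · rw [← h0, zero_mul]
      positivity
    · have h6 : ‖c‖ ≤ ‖⟪x.1, z⟫‖ := le_of_mul_le_mul_left (by rwa [sq] at h5) h0
      rw [sq]
      gcongr
  obtain ⟨s, -, hs⟩ := exists_eq_weakAtom_of_le hA1
  exact ⟨s, x, hs⟩

/-! ### Strength of the complement of a weak atom -/

theorem weakAtom_le_orthocomplement_self {s t : I} {x : Metric.sphere (0 : H) 1} :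
    weakAtom s x ≤ orthocomplement (weakAtom t x) ↔ s ≤ σ t := by
  rw [le_iff_quadForm, ← Subtype.coe_le_coe, unitInterval.coe_symm_eq]
  simp only [quadForm_orthocomplement, quadForm_weakAtom]
  refine ⟨fun h => by simpa [inner_sphere_self] using h x, fun h z => ?_⟩
  have h1 : ‖⟪x.1, z⟫‖ ^ 2 ≤ ‖z‖ ^ 2 := by
    have := norm_inner_le_norm (𝕜 := ℂ) x.1 z
    rw [norm_eq_of_mem_sphere x, one_mul] at this
    gcongr
  nlinarith [sq_nonneg ‖⟪x.1, z⟫‖]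

/-- The constant one half in the unit interval. -/
noncomputable def half : I := ⟨1 / 2, by norm_num, by norm_num⟩

theorem symm_half : σ half = half := by
  ext
  norm_num [half]

/-- The strength of `1 - P / 2` along `y` is `1 / (1 + c)`, where `c` is the transition
probability between `y` and the line of `P`. -/
theorem weakAtom_le_orthocomplement_half {s : I} {x y : Metric.sphere (0 : H) 1} :
    weakAtom s y ≤ orthocomplement (weakAtom half x) ↔ s * (1 + ‖⟪x.1, y.1⟫‖ ^ 2) ≤ 1 := by
  -- The preimage of `y` under `1 - P / 2` is `(1 + P) y`.
  have hw : (orthocomplement (weakAtom half x)).1 (y.1 + ⟪x.1, y.1⟫ • x.1) = y.1 := by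
    change (1 - (weakAtom half x).1) _ = _
    rw [sub_apply, weakAtom_apply, one_apply_eq_self, inner_add_right,
      inner_smul_right, inner_sphere_self, add_sub_assoc, ← sub_smul]
    simp [half]
    left
    ring
  rw [weakAtom_le_iff hw]
  have : quadForm (orthocomplement (weakAtom half x)) (y.1 + ⟪x.1, y.1⟫ • x.1)
      = 1 + ‖⟪x.1, y.1⟫‖ ^ 2 := by
    have h1 := inner_apply_self (orthocomplement (weakAtom half x)) (y.1 + ⟪x.1, y.1⟫ • x.1)
    rw [hw, inner_add_right, inner_smul_right, inner_sphere_self, ← inner_conj_symm y.1 x.1,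
      Complex.mul_conj'] at h1
    exact_mod_cast h1.symm
  rw [this]

end Order

section Wigner

variable {E F : Type*} [NormedAddCommGroup E] [InnerProductSpace ℂ E]
  [NormedAddCommGroup F] [InnerProductSpace ℂ F]

/-! ### Wigner's theorem -/

/-- A group is not the union of two proper subgroups. The subgroups are given by predicates `P`
and `Q`, and only the closure property that the argument needs is required of each. -/
theorem forall_or_forall_of_add {G : Type*} [Add G] {P Q : G → Prop}
    (hP : ∀ a b, P (a + b) → P b → P a) (hQ : ∀ a b, Q (a + b) → Q a → Q b)
    (h : ∀ a, P a ∨ Q a) : (∀ a, P a) ∨ ∀ a, Q a := by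
  by_contra! hc
  obtain ⟨⟨a, ha⟩, b, hb⟩ := hc
  rcases h (a + b) with hab | hab
  · exact ha (hP a b hab ((h b).resolve_right hb))
  · exact hb (hQ a b hab ((h a).resolve_left ha))

theorem norm_eq_of_inner_self_eq {u : F} {y : E} (h : ⟪u, u⟫ = ⟪y, y⟫) : ‖u‖ = ‖y‖ := by
  rw [inner_self_eq_norm_sq_to_K, inner_self_eq_norm_sq_to_K] at h
  norm_cast at h
  exact (sq_eq_sq₀ (norm_nonneg _) (norm_nonneg _)).1 h

theorem map_add_of_re_inner {V : E → F} (h : ∀ x y, (⟪V x, V y⟫).re = (⟪x, y⟫).re) (x y : E) :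
    V (x + y) = V x + V y := by
  rw [← sub_eq_zero, ← sub_sub, ← inner_self_eq_zero (𝕜 := ℂ)]
  have h1 : (⟪V (x + y) - V x - V y, V (x + y) - V x - V y⟫).re = 0 := by
    simp only [inner_sub_left, inner_sub_right, Complex.sub_re, h, inner_add_left, inner_add_right,
      Complex.add_re]
    ring
  have h2 := inner_self_im (𝕜 := ℂ) (V (x + y) - V x - V y)
  exact Complex.ext h1 h2

theorem map_smul_of_inner {V : E → F} (h : ∀ x y, ⟪V x, V y⟫ = ⟪x, y⟫) (c : ℂ) (x : E) :
    V (c • x) = c • V x := by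
  rw [← sub_eq_zero, ← inner_self_eq_zero (𝕜 := ℂ)]
  simp only [inner_sub_left, inner_sub_right, h, inner_smul_left, inner_smul_right]
  ring

theorem map_smul_of_inner_swap {V : E → F} (h : ∀ x y, ⟪V x, V y⟫ = ⟪y, x⟫) (c : ℂ) (x : E) :
    V (c • x) = (starRingEnd ℂ) c • V x := by
  rw [← sub_eq_zero, ← inner_self_eq_zero (𝕜 := ℂ)]
  simp only [inner_sub_left, inner_sub_right, h, inner_smul_left, inner_smul_right,
    Complex.conj_conj]
  ring

/-- A map that preserves the real part and the modulus of the inner product preserves the inner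
product or conjugates it: the imaginary parts agree up to a sign, which is constant because a group
is not the union of two proper subgroups. -/
theorem inner_eq_or_inner_swap {V : E → F} (hre : ∀ x y, (⟪V x, V y⟫).re = (⟪x, y⟫).re)
    (hnorm : ∀ x y, ‖⟪V x, V y⟫‖ = ‖⟪x, y⟫‖) :
    (∀ x y, ⟪V x, V y⟫ = ⟪x, y⟫) ∨ ∀ x y, ⟪V x, V y⟫ = ⟪y, x⟫ := by
  have hadd := map_add_of_re_inner hre
  have him : ∀ x y, (⟪V x, V y⟫).im = (⟪x, y⟫).im ∨ (⟪V x, V y⟫).im = -(⟪x, y⟫).im := by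
    intro x y
    have h := congrArg (· ^ 2) (hnorm x y)
    simp only [Complex.sq_norm, Complex.normSq_apply, hre] at h
    exact sq_eq_sq_iff_eq_or_eq_neg.1 (by nlinarith)
  have h1 : ∀ x, (∀ y, (⟪V x, V y⟫).im = (⟪x, y⟫).im) ∨
      ∀ y, (⟪V x, V y⟫).im = -(⟪x, y⟫).im := by
    intro x
    refine forall_or_forall_of_add (fun a b => ?_) (fun a b => ?_) (him x) <;>
    · simp only [hadd, inner_add_right, Complex.add_im]
      intro h h'
      linarith
  have h2 : (∀ x y, (⟪V x, V y⟫).im = (⟪x, y⟫).im) ∨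
      ∀ x y, (⟪V x, V y⟫).im = -(⟪x, y⟫).im := by
    refine forall_or_forall_of_add (fun a b h h' y => ?_) (fun a b h h' y => ?_) h1 <;>
    · have h := h y
      have h' := h' y
      simp only [hadd, inner_add_left, Complex.add_im] at h
      linarith
  refine h2.imp (fun h x y => Complex.ext (hre x y) (h x y)) fun h x y => ?_
  rw [← inner_conj_symm y x]
  exact Complex.ext (by rw [Complex.conj_re, hre]) (by rw [Complex.conj_im, h])

theorem exists_phase_of_norm_inner {u v : E} (hn : ‖u‖ = ‖v‖) (h : ‖⟪u, v⟫‖ = ‖u‖ * ‖v‖) :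
    ∃ c : ℂ, ‖c‖ = 1 ∧ v = c • u := by
  by_cases hu : u = 0
  · refine ⟨1, by simp, ?_⟩
    rw [hu, norm_zero] at hn
    rw [hu, smul_zero]
    exact norm_eq_zero.1 hn.symm
  have hv : v ≠ 0 := by
    rintro rfl
    rw [norm_zero, norm_eq_zero] at hn
    exact hu hn
  obtain ⟨c, -, hc⟩ := (norm_inner_eq_norm_iff hu hv).1 h
  refine ⟨c, ?_, hc⟩
  have h1 := congrArg norm hc
  rw [norm_smul, ← hn] at h1
  exact (mul_eq_right₀ (norm_ne_zero_iff.2 hu)).1 h1.symm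

/-- **Wigner's theorem**: a map that preserves the moduli of inner products agrees up to phases with
a map that preserves inner products or conjugates them. -/
theorem exists_phase_of_norm_inner_map [Nontrivial E] {S : E → F}
    (hS : ∀ x y, ‖⟪S x, S y⟫‖ = ‖⟪x, y⟫‖) :
    ∃ U : E → F, (∀ x, ∃ c : ℂ, ‖c‖ = 1 ∧ S x = c • U x) ∧
      ((∀ x y, ⟪U x, U y⟫ = ⟪x, y⟫) ∨ ∀ x y, ⟪U x, U y⟫ = ⟪y, x⟫) := by
  have hSn : ∀ x, ‖S x‖ = ‖x‖ := fun x => by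
    have := hS x x
    rw [inner_self_eq_norm_sq_to_K, inner_self_eq_norm_sq_to_K] at this
    simpa using this
  obtain ⟨e, he⟩ := exists_norm_eq E zero_le_one
  have hee : ⟪e, e⟫ = 1 := by simp [inner_self_eq_norm_sq_to_K, he]
  have hSee : ⟪S e, S e⟫ = 1 := by simp [inner_self_eq_norm_sq_to_K, hSn, he]
  -- On the orthogonal complement of `e`, the phase of `S (e + x)` is normalized so that its
  -- component along `S e` is `S e` itself.
  have hV : ∀ x : (ℂ ∙ e)ᗮ, ∃ v : F, ⟪S e, v⟫ = 0 ∧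
      ∃ c : ℂ, ‖c‖ = 1 ∧ S e + v = c • S (e + x) := fun x => by
    have hd : ‖⟪S e, S (e + x)⟫‖ = 1 := by
      rw [hS, inner_add_right, hee, Submodule.mem_orthogonal_singleton_iff_inner_right.1 x.2]
      simp
    have hd0 : ⟪S e, S (e + x)⟫ ≠ 0 := by
      rw [← norm_ne_zero_iff, hd]
      exact one_ne_zero
    refine ⟨(⟪S e, S (e + x)⟫)⁻¹ • S (e + x) - S e, ?_, (⟪S e, S (e + x)⟫)⁻¹, ?_, ?_⟩
    · rw [inner_sub_right, inner_smul_right, inv_mul_cancel₀ hd0, hSee, sub_self]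
    · rw [norm_inv, hd, inv_one]
    · abel
  choose V hVe d hd hVd using hV
  have hVe' : ∀ x, ⟪V x, S e⟫ = 0 := fun x => inner_eq_zero_symm.1 (hVe x)
  have hex : ∀ x : (ℂ ∙ e)ᗮ, ⟪e, x.1⟫ = 0 := fun x =>
    Submodule.mem_orthogonal_singleton_iff_inner_right.1 x.2
  have hex' : ∀ x : (ℂ ∙ e)ᗮ, ⟪x.1, e⟫ = 0 := fun x => inner_eq_zero_symm.1 (hex x)
  have h1 : ∀ x y, ‖1 + ⟪V x, V y⟫‖ = ‖1 + ⟪x, y⟫‖ := fun x y => by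
    have h : ‖⟪S e + V x, S e + V y⟫‖ = ‖⟪e + x.1, e + y.1⟫‖ := by
      rw [hVd, hVd, inner_smul_left, inner_smul_right, norm_mul, norm_mul, RCLike.norm_conj, hd,
        hd, one_mul, one_mul, hS]
    rw [inner_add_left, inner_add_left, inner_add_right, inner_add_right, inner_add_right,
      inner_add_right, hee, hSee, hVe, hVe', hex, hex'] at h
    simp only [add_zero, zero_add] at h
    exact h
  have hVn : ∀ x, ‖V x‖ = ‖x‖ := fun x => by
    have hr : ∀ r : ℝ, ‖(1 : ℂ) + (r : ℂ) ^ 2‖ = 1 + r ^ 2 := fun r => by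
      rw [← Complex.ofReal_pow, ← Complex.ofReal_one, ← Complex.ofReal_add, Complex.norm_real,
        Real.norm_of_nonneg (by positivity)]
    have h := h1 x x
    rw [inner_self_eq_norm_sq_to_K, inner_self_eq_norm_sq_to_K] at h
    have h : 1 + ‖V x‖ ^ 2 = 1 + ‖x‖ ^ 2 := (hr _).symm.trans (h.trans (hr _))
    exact (sq_eq_sq₀ (norm_nonneg _) (norm_nonneg _)).1 (by linarith)
  have hVS : ∀ x, ∃ c : ℂ, ‖c‖ = 1 ∧ V x = c • S x := fun x => by
    have h : ‖⟪S x, S e + V x⟫‖ = ‖⟪x.1, e + x.1⟫‖ := by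
      rw [hVd, inner_smul_right, norm_mul, hd, one_mul, hS]
    have h0 : ⟪S x, S e⟫ = 0 := by rw [← norm_eq_zero, hS, hex', norm_zero]
    rw [inner_add_right, inner_add_right, h0, hex', zero_add, zero_add,
      inner_self_eq_norm_sq_to_K] at h
    refine exists_phase_of_norm_inner (by rw [hVn, hSn]; rfl) ?_
    rw [h, hVn, hSn]
    simp [sq]
  have hVnorm : ∀ x y, ‖⟪V x, V y⟫‖ = ‖⟪x, y⟫‖ := fun x y => by
    obtain ⟨c, hc, hcx⟩ := hVS x
    obtain ⟨c', hc', hcy⟩ := hVS y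
    rw [hcx, hcy, inner_smul_left, inner_smul_right, norm_mul, norm_mul, RCLike.norm_conj, hc,
      hc', one_mul, one_mul, hS]
    rfl
  have hVre : ∀ x y, (⟪V x, V y⟫).re = (⟪x, y⟫).re := fun x y => by
    have h := congrArg (· ^ 2) (h1 x y)
    have h' := congrArg (· ^ 2) (hVnorm x y)
    simp only [Complex.sq_norm, Complex.normSq_apply, Complex.add_re, Complex.add_im,
      Complex.one_re, Complex.one_im] at h h'
    linarith
  -- The component orthogonal to `e`.
  let p : E → (ℂ ∙ e)ᗮ := fun y => ⟨y - ⟪e, y⟫ • e, by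
    rw [Submodule.mem_orthogonal_singleton_iff_inner_right, inner_sub_right, inner_smul_right, hee,
      mul_one, sub_self]⟩
  have hp : ∀ x y, ⟪p x, p y⟫ = ⟪x, y⟫ - (starRingEnd ℂ) ⟪e, x⟫ * ⟪e, y⟫ := fun x y => by
    change ⟪x - ⟪e, x⟫ • e, y - ⟪e, y⟫ • e⟫ = _
    simp only [inner_sub_left, inner_sub_right, inner_smul_left, inner_smul_right, hee,
      ← inner_conj_symm x e]
    ring
  have hpy : ∀ y, y = ⟪e, y⟫ • e + (p y).1 := fun y => by
    simp only [p]
    abel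
  -- Vectors of the form `c (S e + V x)` with `|c| = |⟪e, y⟫|` lie on the line of `S y`.
  have hray : ∀ (y : E) (u : F), ‖u‖ = ‖y‖ →
      (⟪e, y⟫ = 0 → u = V (p y)) →
      (⟪e, y⟫ ≠ 0 → ∃ c : ℂ, ‖c‖ = ‖⟪e, y⟫‖ ∧ u = c • (S e + V ((⟪e, y⟫)⁻¹ • p y))) →
      ∃ c : ℂ, ‖c‖ = 1 ∧ S y = c • u := by
    intro y u hu h0 hne
    refine exists_phase_of_norm_inner (by rw [hu, hSn]) ?_
    rw [hu, hSn]
    by_cases hy : ⟪e, y⟫ = 0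
    · obtain ⟨c, hc, hcy⟩ := hVS (p y)
      have : (p y).1 = y := by simp [p, hy]
      rw [this] at hcy
      rw [h0 hy, hcy, inner_smul_left, norm_mul, RCLike.norm_conj, hc, one_mul, hS,
        inner_self_eq_norm_sq_to_K]
      simp [sq]
    · obtain ⟨c, hc, hcu⟩ := hne hy
      have hy' : ⟪e, y⟫ • (e + ((⟪e, y⟫)⁻¹ • p y : (ℂ ∙ e)ᗮ).1) = y := by
        rw [Submodule.coe_smul, smul_add, smul_inv_smul₀ hy, ← hpy]
      rw [hcu, hVd, inner_smul_left, inner_smul_left, norm_mul, norm_mul, RCLike.norm_conj,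
        RCLike.norm_conj, hd, hc, one_mul, hS, ← RCLike.norm_conj ⟪e, y⟫, ← norm_mul,
        ← inner_smul_left, hy', inner_self_eq_norm_sq_to_K]
      simp [sq]
  rcases inner_eq_or_inner_swap hVre hVnorm with hlin | hconj
  · have hU : ∀ x y, ⟪⟪e, x⟫ • S e + V (p x), ⟪e, y⟫ • S e + V (p y)⟫ = ⟪x, y⟫ := fun x y => by
      simp only [inner_add_left, inner_add_right, inner_smul_left, inner_smul_right, hSee, hVe,
        hVe', hlin, hp]
      ring
    refine ⟨fun y => ⟪e, y⟫ • S e + V (p y), fun y => ?_, Or.inl hU⟩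
    refine hray y _ (norm_eq_of_inner_self_eq (hU y y)) (fun h => by simp [h]) fun h => ⟨_, rfl, ?_⟩
    rw [map_smul_of_inner hlin, smul_add, smul_inv_smul₀ h]
  · have hU : ∀ x y, ⟪(starRingEnd ℂ) ⟪e, x⟫ • S e + V (p x),
        (starRingEnd ℂ) ⟪e, y⟫ • S e + V (p y)⟫ = ⟪y, x⟫ := fun x y => by
      simp only [inner_add_left, inner_add_right, inner_smul_left, inner_smul_right, hSee, hVe,
        hVe', hconj, hp, Complex.conj_conj]
      ring
    refine ⟨fun y => (starRingEnd ℂ) ⟪e, y⟫ • S e + V (p y), fun y => ?_, Or.inr hU⟩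
    refine hray y _ (norm_eq_of_inner_self_eq (hU y y)) (fun h => by simp [h]) fun h =>
      ⟨_, RCLike.norm_conj _, ?_⟩
    rw [map_smul_of_inner_swap hconj, map_inv₀, smul_add, smul_inv_smul₀ ((map_ne_zero _).2 h)]

end Wigner

/-! ### Additive functions on the unit interval -/

/-- Nonnegative functions with `f a + g b + k c = 1` whenever `a + b + c = 1`, normalized at `0`,
are the identity: `f`, `g` and `k` agree and are additive, so the defect `f a - a` doubles when
passing from `a` or `1 - a` to a point of the unit interval, and a bounded defect must vanish. -/
theorem eq_self_of_add_add_eq_one {f g k : ℝ → ℝ} (hf : ∀ a ∈ I, 0 ≤ f a)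
    (hf0 : f 0 = 0) (hg0 : g 0 = 0) (hk0 : k 0 = 0)
    (h : ∀ a b c, 0 ≤ a → 0 ≤ b → 0 ≤ c → a + b + c = 1 → f a + g b + k c = 1) :
    ∀ a ∈ I, f a = a := by
  have hsymm : ∀ a ∈ I, f a + f (1 - a) = 1 := fun a ha => by
    have h1 := h a (1 - a) 0 ha.1 (by linarith [ha.2]) le_rfl (by ring)
    have h2 := h (1 - a) 0 a (by linarith [ha.2]) le_rfl ha.1 (by ring)
    have h3 := h 0 (1 - a) a le_rfl (by linarith [ha.2]) ha.1 (by ring)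
    linarith
  have hdouble : ∀ a, 0 ≤ a → a ≤ 1 / 2 → f (2 * a) = 2 * f a := fun a h0 h1 => by
    have h2 := h a a (1 - 2 * a) h0 h0 (by linarith) (by ring)
    have h3 := h 0 a (1 - a) le_rfl h0 (by linarith) (by ring)
    have h4 := h a 0 (1 - a) h0 le_rfl (by linarith) (by ring)
    have h5 := h (2 * a) 0 (1 - 2 * a) (by linarith) le_rfl (by linarith) (by ring)
    linarith
  have hbound : ∀ n : ℕ, ∀ a ∈ I, |f a - a| ≤ (1 / 2) ^ n := by
    intro n
    induction n with
    | zero =>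
      intro a ha
      have h1 := hsymm a ha
      have h2 := hf a ha
      have h3 := hf (1 - a) ⟨by linarith [ha.2], by linarith [ha.1]⟩
      rw [pow_zero, abs_le]
      exact ⟨by linarith [ha.2], by linarith [ha.1]⟩
    | succ n ih =>
      have half_le : ∀ a, 0 ≤ a → a ≤ 1 / 2 → |f a - a| ≤ (1 / 2) ^ (n + 1) := fun a h0 h1 => by
        have h2 := ih (2 * a) ⟨by linarith, by linarith⟩
        rw [hdouble a h0 h1, ← mul_sub, abs_mul, abs_two] at h2
        rw [pow_succ]
        linarith
      intro a ha
      rcases le_total a (1 / 2) with h1 | h1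
      · exact half_le a ha.1 h1
      · have h2 := half_le (1 - a) (by linarith [ha.2]) (by linarith)
        rwa [show f (1 - a) - (1 - a) = -(f a - a) by linarith [hsymm a ha], abs_neg] at h2
  intro a ha
  rw [← sub_eq_zero, ← abs_nonpos_iff]
  exact ge_of_tendsto' (tendsto_pow_atTop_nhds_zero_of_lt_one (by norm_num) (by norm_num))
    fun n => hbound n a ha

section Orthogonality

variable {H : Type*} [NormedAddCommGroup H] [InnerProductSpace ℂ H]

theorem exists_unit_orthogonal (hdim : 3 ≤ Module.rank ℂ H) (u v : H) :
    ∃ z : Metric.sphere (0 : H) 1, ⟪u, z.1⟫ = 0 ∧ ⟪v, z.1⟫ = 0 := by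
  classical
  have hW : Submodule.span ℂ ((({u, v} : Finset H)) : Set H) ≠ ⊤ := fun htop => by
    have h1 := rank_span_finset_le (R := ℂ) ({u, v} : Finset H)
    rw [htop, rank_top] at h1
    have h2 := hdim.trans h1
    have h3 : ({u, v} : Finset H).card ≤ 2 := Finset.card_le_two
    have h4 : 3 ≤ ({u, v} : Finset H).card := by exact_mod_cast h2
    omega
  rw [Ne, ← Submodule.orthogonal_eq_bot_iff] at hW
  obtain ⟨z, hz, hz0⟩ := Submodule.exists_mem_ne_zero_of_ne_bot hW
  rw [Submodule.mem_orthogonal] at hz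
  refine ⟨⟨((‖z‖⁻¹ : ℝ) : ℂ) • z, ?_⟩, ?_, ?_⟩
  · rw [mem_sphere_zero_iff_norm, norm_smul, Complex.norm_real, norm_inv, norm_norm,
      inv_mul_cancel₀ (norm_ne_zero_iff.2 hz0)]
  · rw [inner_smul_right, hz u (Submodule.subset_span (by simp)), mul_zero]
  · rw [inner_smul_right, hz v (Submodule.subset_span (by simp)), mul_zero]

theorem exists_orthonormal_triple (hdim : 3 ≤ Module.rank ℂ H) (x : Metric.sphere (0 : H) 1) :
    ∃ v : Fin 3 → Metric.sphere (0 : H) 1, v 0 = x ∧ Orthonormal ℂ fun i => (v i).1 := by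
  obtain ⟨y, hy, -⟩ := exists_unit_orthogonal hdim x.1 x.1
  obtain ⟨z, hz, hz'⟩ := exists_unit_orthogonal hdim x.1 y.1
  refine ⟨![x, y, z], rfl, fun i => norm_eq_of_mem_sphere _, fun i j hij => ?_⟩
  fin_cases i <;> fin_cases j <;>
    first
    | exact absurd rfl hij
    | assumption
    | exact inner_eq_zero_symm.1 (by assumption)

end Orthogonality

section OrderIso

variable {H : Type*} [NormedAddCommGroup H] [InnerProductSpace ℂ H] [CompleteSpace H]

/-! ### Action of an order automorphism on weak atoms -/

theorem isChain_Iic_map (e : effects H ≃o effects H) {A : effects H}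
    (h : IsChain (· ≤ ·) (Set.Iic A)) : IsChain (· ≤ ·) (Set.Iic (e A)) := by
  intro B hB C hC _
  have := h.total (x := e.symm B) (y := e.symm C) (e.symm_apply_le.2 hB) (e.symm_apply_le.2 hC)
  simpa using this

/-- Rank-one projections are the maximal weak atoms. -/
theorem exists_map_weakAtom_one [Nontrivial H] (e : effects H ≃o effects H)
    (x : Metric.sphere (0 : H) 1) : ∃ y, e (weakAtom 1 x) = weakAtom 1 y := by
  obtain ⟨t, y, hy⟩ := exists_eq_weakAtom_of_isChain
    (isChain_Iic_map e (isChain_Iic_weakAtom 1 x))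
  obtain ⟨s, z, hz⟩ := exists_eq_weakAtom_of_isChain
    (isChain_Iic_map e.symm (isChain_Iic_weakAtom 1 y))
  have h1 : weakAtom 1 x ≤ weakAtom s z := by
    rw [← hz, e.le_symm_apply, hy, weakAtom_le_weakAtom]
    exact le_one'
  obtain ⟨u, hu, hux⟩ := exists_eq_weakAtom_of_le h1
  obtain ⟨c, hc, hxz⟩ := eq_smul_of_weakAtom_le one_ne_zero h1
  rw [weakAtom_eq_of_eq_smul hc hxz, weakAtom_inj] at hux
  have hs : s = 1 := le_antisymm le_one' (hux ▸ hu)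
  refine ⟨y, ?_⟩
  rw [weakAtom_eq_of_eq_smul hc hxz, ← e.apply_symm_apply (weakAtom 1 y), hz, hs]

/-- An order automorphism permutes the lines by a map `T` of unit vectors, and maps the weak atoms
of the line of `x` to those of the line of `T x` by an order automorphism `h x` of `[0, 1]`. -/
theorem exists_map_weakAtom [Nontrivial H] (e : effects H ≃o effects H) :
    ∃ (T : Metric.sphere (0 : H) 1 → Metric.sphere (0 : H) 1)
      (h : Metric.sphere (0 : H) 1 → (I ≃o I)),
      ∀ x t, e (weakAtom t x) = weakAtom (h x t) (T x) := by
  choose T hT using exists_map_weakAtom_one e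
  have hex : ∀ x t, ∃ s, e (weakAtom t x) = weakAtom s (T x) := fun x t => by
    have h1 : e (weakAtom t x) ≤ weakAtom 1 (T x) := by
      rw [← hT, e.le_iff_le, weakAtom_le_weakAtom]
      exact le_one'
    obtain ⟨s, -, hs⟩ := exists_eq_weakAtom_of_le h1
    exact ⟨s, hs⟩
  choose h hh using hex
  have hle : ∀ x s t, h x s ≤ h x t ↔ s ≤ t := fun x s t => by
    rw [← weakAtom_le_weakAtom (x := T x), ← hh, ← hh, e.le_iff_le, weakAtom_le_weakAtom]
  have hsurj : ∀ x, Function.Surjective (h x) := fun x u => by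
    have h1 : e.symm (weakAtom u (T x)) ≤ weakAtom 1 x := by
      rw [e.symm_apply_le, hT, weakAtom_le_weakAtom]
      exact le_one'
    obtain ⟨s, -, hs⟩ := exists_eq_weakAtom_of_le h1
    rw [e.symm_apply_eq, hh, weakAtom_inj] at hs
    exact ⟨s, hs.symm⟩
  exact ⟨T, fun x => OrderIso.ofSurjective (OrderEmbedding.ofMapLEIff (h x) (hle x)) (hsurj x), hh⟩

/-- The map `T` reaches every line. -/
theorem exists_phase_eq_map {e : effects H ≃o effects H}
    {T : Metric.sphere (0 : H) 1 → Metric.sphere (0 : H) 1} {h : Metric.sphere (0 : H) 1 → (I ≃o I)}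
    [Nontrivial H] (he : ∀ x t, e (weakAtom t x) = weakAtom (h x t) (T x))
    (z : Metric.sphere (0 : H) 1) : ∃ x, ∃ c : ℂ, ‖c‖ = 1 ∧ z.1 = c • (T x).1 := by
  obtain ⟨x, hx⟩ := exists_map_weakAtom_one e.symm z
  rw [e.symm_apply_eq, he] at hx
  exact ⟨x, eq_smul_of_weakAtom_le one_ne_zero hx.le⟩

/-! ### Transition probabilities -/

/-- The relation `s P ≤ 1 - t P` means `s ≤ 1 - t`, so the action on strengths commutes with
`t ↦ 1 - t`. -/
theorem map_symm
    {e : effects H ≃o effects H} (horth : ∀ A, e (orthocomplement A) = orthocomplement (e A))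
    {T : Metric.sphere (0 : H) 1 → Metric.sphere (0 : H) 1} {h : Metric.sphere (0 : H) 1 → (I ≃o I)}
    (he : ∀ x t, e (weakAtom t x) = weakAtom (h x t) (T x))
    (x : Metric.sphere (0 : H) 1) (t : I) : h x (σ t) = σ (h x t) := by
  have key : ∀ s, s ≤ σ t ↔ h x s ≤ σ (h x t) := fun s => by
    rw [← weakAtom_le_orthocomplement_self (x := x), ← weakAtom_le_orthocomplement_self (x := T x),
      ← he, ← he, ← horth, e.le_iff_le]
  refine le_antisymm ((key _).1 le_rfl) ?_
  rw [← (h x).symm_apply_le, key, (h x).apply_symm_apply]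

theorem map_half
    {e : effects H ≃o effects H} (horth : ∀ A, e (orthocomplement A) = orthocomplement (e A))
    {T : Metric.sphere (0 : H) 1 → Metric.sphere (0 : H) 1} {h : Metric.sphere (0 : H) 1 → (I ≃o I)}
    (he : ∀ x t, e (weakAtom t x) = weakAtom (h x t) (T x))
    (x : Metric.sphere (0 : H) 1) : h x half = half := by
  have h1 := congrArg Subtype.val (map_symm horth he x half)
  rw [symm_half, coe_symm_eq] at h1
  ext
  change _ = (1 / 2 : ℝ)
  linarith

/-- Since `1/2` is fixed, `1 - P / 2` is mapped to an effect of the same form, and the strengths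
along `y` and `T y` correspond under `h y`. -/
theorem strength_map_iff
    {e : effects H ≃o effects H} (horth : ∀ A, e (orthocomplement A) = orthocomplement (e A))
    {T : Metric.sphere (0 : H) 1 → Metric.sphere (0 : H) 1} {h : Metric.sphere (0 : H) 1 → (I ≃o I)}
    (he : ∀ x t, e (weakAtom t x) = weakAtom (h x t) (T x))
    (x y : Metric.sphere (0 : H) 1) (s : I) :
    h y s * (1 + ‖⟪(T x).1, (T y).1⟫‖ ^ 2) ≤ 1 ↔ s * (1 + ‖⟪x.1, y.1⟫‖ ^ 2) ≤ 1 := by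
  rw [← weakAtom_le_orthocomplement_half, ← weakAtom_le_orthocomplement_half,
    ← map_half horth he x, ← he, ← he, ← horth, e.le_iff_le, map_half horth he x]

/-- The strength `1 / (1 + c)` along a unit vector of `1 - P / 2`, where `c` is the transition
probability. It is projected to the unit interval, which changes nothing for `0 ≤ c`. -/
noncomputable def halfStrength (c : ℝ) : I := Set.projIcc 0 1 zero_le_one (1 / (1 + c))

theorem coe_halfStrength {c : ℝ} (hc : 0 ≤ c) : (halfStrength c : ℝ) = 1 / (1 + c) := by
  rw [halfStrength, Set.projIcc_of_mem _ ⟨by positivity, by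
    rw [div_le_one (by positivity)]
    linarith⟩]

theorem le_halfStrength {c : ℝ} (hc : 0 ≤ c) {s : I} : s ≤ halfStrength c ↔ s * (1 + c) ≤ 1 := by
  rw [← Subtype.coe_le_coe, coe_halfStrength hc, le_div_iff₀ (by positivity)]

theorem map_halfStrength
    {e : effects H ≃o effects H} (horth : ∀ A, e (orthocomplement A) = orthocomplement (e A))
    {T : Metric.sphere (0 : H) 1 → Metric.sphere (0 : H) 1} {h : Metric.sphere (0 : H) 1 → (I ≃o I)}
    (he : ∀ x t, e (weakAtom t x) = weakAtom (h x t) (T x))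
    (x y : Metric.sphere (0 : H) 1) :
    h y (halfStrength (‖⟪x.1, y.1⟫‖ ^ 2)) = halfStrength (‖⟪(T x).1, (T y).1⟫‖ ^ 2) := by
  have key : ∀ s, s ≤ halfStrength (‖⟪x.1, y.1⟫‖ ^ 2) ↔
      h y s ≤ halfStrength (‖⟪(T x).1, (T y).1⟫‖ ^ 2) := fun s => by
    rw [le_halfStrength (by positivity), le_halfStrength (by positivity),
      strength_map_iff horth he]
  refine le_antisymm ((key _).1 le_rfl) ?_
  rw [← (h y).symm_apply_le, key, (h y).apply_symm_apply]

/-- The function through which an automorphism acts on the transition probabilities to a fixed unit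
vector: `c ↦ 1 / h (1 / (1 + c)) - 1`, where `h` is the action on strengths. For `0 ≤ c` the
denominator is positive. -/
noncomputable def transitionMap (h : I ≃o I) (c : ℝ) : ℝ := 1 / (h (halfStrength c) : ℝ) - 1

theorem transitionMap_zero (h : I ≃o I) : transitionMap h 0 = 0 := by
  have h1 : halfStrength 0 = 1 := by
    ext
    rw [coe_halfStrength le_rfl]
    norm_num
  have h2 : h 1 = 1 := h.map_top
  rw [transitionMap, h1, h2]
  norm_num

theorem transitionMap_nonneg (h : I ≃o I) {c : ℝ} (hc : 0 ≤ c) : 0 ≤ transitionMap h c := by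
  rw [transitionMap, sub_nonneg]
  rcases (h (halfStrength c)).2.1.eq_or_lt with h0 | h0
  · exfalso
    have h1 : h (halfStrength c) = h 0 := by
      rw [show h 0 = 0 from h.map_bot]
      exact Subtype.ext h0.symm
    have h2 := congrArg Subtype.val (h.injective h1)
    rw [coe_halfStrength hc] at h2
    have h3 : 0 < 1 / (1 + c) := by positivity
    exact h3.ne' h2
  · rw [le_div_iff₀ h0, one_mul]
    exact (h (halfStrength c)).2.2

theorem norm_inner_map_sq
    {e : effects H ≃o effects H} (horth : ∀ A, e (orthocomplement A) = orthocomplement (e A))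
    {T : Metric.sphere (0 : H) 1 → Metric.sphere (0 : H) 1} {h : Metric.sphere (0 : H) 1 → (I ≃o I)}
    (he : ∀ x t, e (weakAtom t x) = weakAtom (h x t) (T x))
    (x y : Metric.sphere (0 : H) 1) :
    ‖⟪(T x).1, (T y).1⟫‖ ^ 2 = transitionMap (h y) (‖⟪x.1, y.1⟫‖ ^ 2) := by
  rw [transitionMap, map_halfStrength horth he, coe_halfStrength (by positivity), one_div_one_div]
  ring

theorem inner_map_eq_zero_iff
    {e : effects H ≃o effects H} (horth : ∀ A, e (orthocomplement A) = orthocomplement (e A))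
    {T : Metric.sphere (0 : H) 1 → Metric.sphere (0 : H) 1} {h : Metric.sphere (0 : H) 1 → (I ≃o I)}
    (he : ∀ x t, e (weakAtom t x) = weakAtom (h x t) (T x))
    (x y : Metric.sphere (0 : H) 1) : ⟪(T x).1, (T y).1⟫ = 0 ↔ ⟪x.1, y.1⟫ = 0 := by
  have hz : ∀ {c : ℝ}, 0 ≤ c → (1 ≤ halfStrength c ↔ c = 0) := fun {c} hc => by
    rw [le_halfStrength hc, Set.Icc.coe_one, one_mul]
    exact ⟨fun h => le_antisymm (by linarith) hc, fun h => by rw [h, add_zero]⟩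
  have hone : h y 1 = 1 := (h y).map_top
  have key : (1 ≤ halfStrength (‖⟪(T x).1, (T y).1⟫‖ ^ 2) ↔
      1 ≤ halfStrength (‖⟪x.1, y.1⟫‖ ^ 2)) := by
    have h1 := (h y).le_iff_le (x := 1) (y := halfStrength (‖⟪x.1, y.1⟫‖ ^ 2))
    rwa [hone, map_halfStrength horth he] at h1
  rw [hz (by positivity), hz (by positivity)] at key
  simpa using key

/-- Orthogonality is preserved in both directions, hence so are orthonormal families and their
spans. Therefore the transition probabilities from a unit vector `y` in the span of an
orthonormal family still add up to `1` after applying `T`. -/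
theorem sum_norm_inner_map_sq [Nontrivial H] {ι : Type*} [Fintype ι]
    {e : effects H ≃o effects H} (horth : ∀ A, e (orthocomplement A) = orthocomplement (e A))
    {T : Metric.sphere (0 : H) 1 → Metric.sphere (0 : H) 1} {h : Metric.sphere (0 : H) 1 → (I ≃o I)}
    (he : ∀ x t, e (weakAtom t x) = weakAtom (h x t) (T x))
    {v : ι → Metric.sphere (0 : H) 1} (hv : Orthonormal ℂ fun i => (v i).1)
    {y : Metric.sphere (0 : H) 1} (hy : ∀ z, (∀ i, ⟪(v i).1, z⟫ = 0) → ⟪y.1, z⟫ = 0) :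
    ∑ i, ‖⟪(T (v i)).1, (T y).1⟫‖ ^ 2 = 1 := by
  classical
  have hTv : Orthonormal ℂ fun i => (T (v i)).1 :=
    ⟨fun i => norm_eq_of_mem_sphere _, fun i j hij =>
      (inner_map_eq_zero_iff horth he _ _).2 (hv.2 hij)⟩
  -- The component of `T y` orthogonal to all `T (v i)`.
  set r : H := (T y).1 - ∑ i, ⟪(T (v i)).1, (T y).1⟫ • (T (v i)).1 with hr
  have hvr : ∀ i, ⟪(T (v i)).1, r⟫ = 0 := fun i => by
    rw [hr, inner_sub_right, hTv.inner_right_fintype, sub_self]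
  have hyr : ⟪(T y).1, r⟫ = 0 := by
    by_cases hr0 : r = 0
    · rw [hr0, inner_zero_right]
    have hn : ((‖r‖ : ℝ) : ℂ) ≠ 0 := by simpa using hr0
    let z : Metric.sphere (0 : H) 1 := ⟨((‖r‖⁻¹ : ℝ) : ℂ) • r, by
      rw [mem_sphere_zero_iff_norm, norm_smul, Complex.norm_real, norm_inv, norm_norm,
        inv_mul_cancel₀ (norm_ne_zero_iff.2 hr0)]⟩
    obtain ⟨x, c, hc, hx⟩ := exists_phase_eq_map he z
    have hc0 : c ≠ 0 := by
      rintro rfl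
      simp at hc
    have hrx : r = (‖r‖ * c : ℂ) • (T x).1 := by
      rw [mul_smul, ← hx]
      change r = _ • ((‖r‖⁻¹ : ℝ) : ℂ) • r
      rw [smul_smul, Complex.ofReal_inv, mul_inv_cancel₀ hn, one_smul]
    have hiff : ∀ w : H, ⟪w, r⟫ = 0 ↔ ⟪w, (T x).1⟫ = 0 := fun w => by
      rw [hrx, inner_smul_right]
      simp [hc0, hr0]
    rw [hiff, inner_map_eq_zero_iff horth he]
    exact hy x fun i => (inner_map_eq_zero_iff horth he _ _).1 ((hiff _).1 (hvr i))
  have h1 : ⟪(T y).1, (T y).1⟫ = ∑ i, ((‖⟪(T (v i)).1, (T y).1⟫‖ ^ 2 : ℝ) : ℂ) := by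
    have h2 : ⟪(T y).1, (T y).1 - r⟫ = ∑ i, ((‖⟪(T (v i)).1, (T y).1⟫‖ ^ 2 : ℝ) : ℂ) := by
      rw [hr, sub_sub_cancel, inner_sum]
      refine Finset.sum_congr rfl fun i _ => ?_
      rw [inner_smul_right, ← inner_conj_symm (T y).1, Complex.mul_conj']
      norm_cast
    rwa [inner_sub_right, hyr, sub_zero] at h2
  rw [inner_sphere_self] at h1
  exact_mod_cast h1.symm

/-- In dimension at least three, transition probabilities are preserved: if `a`, `b`, `c` are those
of a unit vector to an orthonormal triple, then the values of the transition maps of the triple at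
`a`, `b`, `c` add up to `1`, and `eq_self_of_add_add_eq_one` applies. -/
theorem transitionMap_eq_self (hdim : 3 ≤ Module.rank ℂ H)
    {e : effects H ≃o effects H} (horth : ∀ A, e (orthocomplement A) = orthocomplement (e A))
    {T : Metric.sphere (0 : H) 1 → Metric.sphere (0 : H) 1} {h : Metric.sphere (0 : H) 1 → (I ≃o I)}
    (he : ∀ x t, e (weakAtom t x) = weakAtom (h x t) (T x))
    (x : Metric.sphere (0 : H) 1) {c : ℝ} (hc : c ∈ I) : transitionMap (h x) c = c := by
  have : Nontrivial H := ⟨x.1, 0, ne_zero_of_mem_unit_sphere x⟩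
  obtain ⟨v, rfl, hv⟩ := exists_orthonormal_triple hdim x
  refine eq_self_of_add_add_eq_one (fun a ha => transitionMap_nonneg (h (v 0)) ha.1)
    (transitionMap_zero _) (transitionMap_zero (h (v 1))) (transitionMap_zero (h (v 2)))
    (fun a b c ha hb hc habc => ?_) c hc
  -- The unit vector with transition probabilities `a`, `b`, `c` to the triple.
  let l : Fin 3 → ℂ := ![(√a : ℝ), (√b : ℝ), (√c : ℝ)]
  have hsqrt : ∀ {r : ℝ}, 0 ≤ r → ‖((√r : ℝ) : ℂ)‖ ^ 2 = r := fun hr => by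
    rw [Complex.norm_real, Real.norm_eq_abs, sq_abs, Real.sq_sqrt hr]
  have hl0 : ‖l 0‖ ^ 2 = a := hsqrt ha
  have hl1 : ‖l 1‖ ^ 2 = b := hsqrt hb
  have hl2 : ‖l 2‖ ^ 2 = c := hsqrt hc
  have hl : ∀ i, ⟪(v i).1, ∑ j, l j • (v j).1⟫ = l i := hv.inner_right_fintype l
  have hy : ‖∑ j, l j • (v j).1‖ = 1 := by
    have h1 : ⟪∑ j, l j • (v j).1, ∑ j, l j • (v j).1⟫ = 1 := by
      rw [sum_inner]
      simp_rw [inner_smul_left, hl, Complex.conj_mul']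
      rw [Fin.sum_univ_three]
      norm_cast
      rw [hl0, hl1, hl2, habc]
    rw [inner_self_eq_norm_sq_to_K] at h1
    have h2 : ‖∑ j, l j • (v j).1‖ ^ 2 = 1 := Complex.ofReal_injective (by push_cast; exact h1)
    exact (pow_eq_one_iff_of_nonneg (norm_nonneg _) two_ne_zero).1 h2
  let y : Metric.sphere (0 : H) 1 := ⟨∑ j, l j • (v j).1, mem_sphere_zero_iff_norm.2 hy⟩
  have hsum := sum_norm_inner_map_sq horth he hv (y := y) fun z hz => by
    change ⟪∑ j, l j • (v j).1, z⟫ = 0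
    rw [sum_inner]
    simp [inner_smul_left, hz]
  have htr : ∀ i, ‖⟪(T (v i)).1, (T y).1⟫‖ ^ 2 = transitionMap (h (v i)) (‖l i‖ ^ 2) := fun i => by
    rw [norm_inner_symm, norm_inner_map_sq horth he, norm_inner_symm, ← hl i]
  rwa [Fin.sum_univ_three, htr, htr, htr, hl0, hl1, hl2] at hsum

theorem norm_inner_map (hdim : 3 ≤ Module.rank ℂ H)
    {e : effects H ≃o effects H} (horth : ∀ A, e (orthocomplement A) = orthocomplement (e A))
    {T : Metric.sphere (0 : H) 1 → Metric.sphere (0 : H) 1} {h : Metric.sphere (0 : H) 1 → (I ≃o I)}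
    (he : ∀ x t, e (weakAtom t x) = weakAtom (h x t) (T x))
    (x y : Metric.sphere (0 : H) 1) : ‖⟪(T x).1, (T y).1⟫‖ = ‖⟪x.1, y.1⟫‖ := by
  have h1 : ‖⟪x.1, y.1⟫‖ ≤ 1 := by simpa using norm_inner_le_norm (𝕜 := ℂ) x.1 y.1
  have h2 := norm_inner_map_sq horth he x y
  rw [transitionMap_eq_self hdim horth he y
    ⟨by positivity, pow_le_one₀ (norm_nonneg _) h1⟩] at h2
  exact (sq_eq_sq₀ (norm_nonneg _) (norm_nonneg _)).1 h2

/-- The action on strengths is trivial: on `[1/2, 1]` because transition probabilities are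
preserved, and on `[0, 1/2]` by complementation. -/
theorem map_strength_eq_self (hdim : 3 ≤ Module.rank ℂ H)
    {e : effects H ≃o effects H} (horth : ∀ A, e (orthocomplement A) = orthocomplement (e A))
    {T : Metric.sphere (0 : H) 1 → Metric.sphere (0 : H) 1} {h : Metric.sphere (0 : H) 1 → (I ≃o I)}
    (he : ∀ x t, e (weakAtom t x) = weakAtom (h x t) (T x))
    (x : Metric.sphere (0 : H) 1) (t : I) : h x t = t := by
  have upper : ∀ t : I, 1 / 2 ≤ (t : ℝ) → h x t = t := fun t ht => by
    have ht0 : 0 < (t : ℝ) := by linarith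
    have hc : 1 / (t : ℝ) - 1 ∈ I := ⟨by
      rw [sub_nonneg, le_div_iff₀ ht0, one_mul]
      exact t.2.2, by
      rw [sub_le_iff_le_add, div_le_iff₀ ht0]
      linarith⟩
    have h1 := transitionMap_eq_self hdim horth he x hc
    have h2 : halfStrength (1 / (t : ℝ) - 1) = t := by
      ext
      rw [coe_halfStrength hc.1, add_sub_cancel, one_div_one_div]
    rw [transitionMap, h2, sub_left_inj, one_div, one_div, inv_inj] at h1
    exact Subtype.ext h1
  rcases le_total (1 / 2) (t : ℝ) with ht | ht
  · exact upper t ht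
  · have h1 := upper (σ t) (by
      rw [coe_symm_eq]
      linarith)
    rw [map_symm horth he] at h1
    exact symm_bijective.injective h1

end OrderIso

section Representation

variable {H : Type*} [NormedAddCommGroup H] [InnerProductSpace ℂ H] [CompleteSpace H]

/-! ### Representation by a unitary or antiunitary operator -/

/-- An order automorphism that acts on weak atoms through a surjection `U` preserving transition
probabilities acts through `U` on all quadratic forms, because an effect is the pointwise supremum
of the weak atoms below it. -/
theorem quadForm_map_eq {e : effects H ≃o effects H} {U : H → H}
    (hU : ∀ x y, ‖⟪U x, U y⟫‖ = ‖⟪x, y⟫‖)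
    (he : ∀ t x z, quadForm (e (weakAtom t x)) z = t * ‖⟪U x.1, z⟫‖ ^ 2)
    (hsurj : ∀ t y, ∃ x, weakAtom t y = e (weakAtom t x)) (A : effects H) (w : H) :
    quadForm (e A) (U w) = quadForm A w := by
  have hatom : ∀ t x, quadForm (e (weakAtom t x)) (U w) = quadForm (weakAtom t x) w :=
    fun t x => by rw [he, hU, quadForm_weakAtom]
  have hzero : ∀ {B : effects H} {z : H}, B.1 z = 0 → quadForm B z = 0 := fun hz => by
    rw [quadForm, reApplyInnerSelf_apply, hz, inner_zero_left, map_zero]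
  apply le_antisymm
  · by_cases h0 : (e A).1 (U w) = 0
    · rw [hzero h0]
      exact quadForm_nonneg A w
    · obtain ⟨t, y, -, hy, hq⟩ := exists_weakAtom_le h0
      obtain ⟨x, hx⟩ := hsurj t y
      rw [hx, e.le_iff_le] at hy
      rw [← hq, hx, hatom]
      exact le_iff_quadForm.1 hy w
  · by_cases h0 : A.1 w = 0
    · rw [hzero h0]
      exact quadForm_nonneg _ _
    · obtain ⟨t, x, -, hx, hq⟩ := exists_weakAtom_le h0
      rw [← hq, ← hatom]
      exact le_iff_quadForm.1 (e.monotone hx) _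

/-- An ortho-order automorphism is implemented on quadratic forms by a surjection that preserves
inner products or conjugates them. -/
theorem exists_implementing_map (hdim : 3 ≤ Module.rank ℂ H) (e : effects H ≃o effects H)
    (horth : ∀ A, e (orthocomplement A) = orthocomplement (e A)) :
    ∃ U : H → H, Function.Surjective U ∧ (∀ A w, quadForm (e A) (U w) = quadForm A w) ∧
      ((∀ x y, ⟪U x, U y⟫ = ⟪x, y⟫) ∨ ∀ x y, ⟪U x, U y⟫ = ⟪y, x⟫) := by
  have hnt : Nontrivial H := by
    rw [← rank_pos_iff_nontrivial (R := ℂ)]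
    exact lt_of_lt_of_le (by norm_num) hdim
  obtain ⟨T, h, he⟩ := exists_map_weakAtom e
  have hT : ∀ x t, e (weakAtom t x) = weakAtom t (T x) := fun x t => by
    rw [he, map_strength_eq_self hdim horth he]
  -- The homogeneous extension of `T` to all vectors.
  have hS : ∀ x : H, ∃ u : Metric.sphere (0 : H) 1, x = ((‖x‖ : ℝ) : ℂ) • u.1 := fun x => by
    by_cases hx : x = 0
    · obtain ⟨u, hu⟩ := exists_norm_eq H zero_le_one
      exact ⟨⟨u, mem_sphere_zero_iff_norm.2 hu⟩, by simp [hx]⟩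
    · have hn : ((‖x‖ : ℝ) : ℂ) ≠ 0 := by simpa using hx
      refine ⟨⟨((‖x‖ : ℝ) : ℂ)⁻¹ • x, ?_⟩, (smul_inv_smul₀ hn x).symm⟩
      rw [mem_sphere_zero_iff_norm, norm_smul, norm_inv, Complex.norm_real, norm_norm,
        inv_mul_cancel₀ (norm_ne_zero_iff.2 hx)]
  choose u hu using hS
  have hSnorm : ∀ x y, ‖⟪((‖x‖ : ℝ) : ℂ) • (T (u x)).1, ((‖y‖ : ℝ) : ℂ) • (T (u y)).1⟫‖ =
      ‖⟪x, y⟫‖ := fun x y => by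
    conv_rhs => rw [hu x, hu y]
    simp only [inner_smul_left, inner_smul_right, norm_mul, norm_inner_map hdim horth he]
  obtain ⟨U, hUS, hUinner⟩ := exists_phase_of_norm_inner_map hSnorm
  have hU : ∀ x y, ‖⟪U x, U y⟫‖ = ‖⟪x, y⟫‖ := fun x y => by
    rcases hUinner with hlin | hconj
    · rw [hlin]
    · rw [hconj, norm_inner_symm]
  have hUsmul : ∀ (c : ℂ) (x : H), ∃ y, U y = c • U x := fun c x => by
    rcases hUinner with hlin | hconj
    · exact ⟨c • x, map_smul_of_inner hlin c x⟩
    · refine ⟨(starRingEnd ℂ) c • x, ?_⟩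
      rw [map_smul_of_inner_swap hconj, Complex.conj_conj]
  -- On unit vectors `U` agrees with `T` up to a phase.
  have hUT : ∀ x : Metric.sphere (0 : H) 1, ∃ c : ℂ, ‖c‖ = 1 ∧ (T x).1 = c • U x := fun x => by
    have hux : u x = x := by
      ext
      conv_rhs => rw [hu x]
      simp
    obtain ⟨c, hc, hcx⟩ := hUS x
    rw [hux, norm_eq_of_mem_sphere, Complex.ofReal_one, one_smul] at hcx
    exact ⟨c, hc, hcx⟩
  have hTsurj : ∀ z : Metric.sphere (0 : H) 1, ∃ x, ∃ c : ℂ, ‖c‖ = 1 ∧ z.1 = c • (T x).1 :=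
    exists_phase_eq_map he
  refine ⟨U, fun w => ?_, fun A w => quadForm_map_eq hU (fun t x z => ?_) (fun t y => ?_) A w,
    hUinner⟩
  · obtain ⟨x, c, -, hx⟩ := hTsurj (u w)
    obtain ⟨c', -, hc'⟩ := hUT x
    obtain ⟨y, hy⟩ := hUsmul (‖w‖ * (c * c')) x
    refine ⟨y, ?_⟩
    rw [hy, mul_smul, mul_smul, ← hc', ← hx, ← hu]
  · obtain ⟨c, hc, hcx⟩ := hUT x
    rw [hT, quadForm_weakAtom, hcx, inner_smul_left, norm_mul, RCLike.norm_conj, hc, one_mul]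
  · obtain ⟨x, c, hc, hx⟩ := hTsurj y
    exact ⟨x, by rw [hT, weakAtom_eq_of_eq_smul hc hx]⟩

/-- An effect is determined by its quadratic form on the range of a surjection. -/
theorem coe_eq_of_inner_apply_self {B : effects H} {C : H →L[ℂ] H} {U : H → H}
    (hsurj : Function.Surjective U) (h : ∀ w, ⟪C (U w), U w⟫ = quadForm B (U w)) : B.1 = C := by
  have h1 : (B.1 : H →ₗ[ℂ] H) = (C : H →ₗ[ℂ] H) := by
    rw [← ext_inner_map]
    intro z
    obtain ⟨w, rfl⟩ := hsurj z
    exact (inner_apply_self B _).trans (h w).symm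
  exact ContinuousLinearMap.coe_injective h1

end Representation

end EffectAlgebra

theorem theorem3p2 {H : Type*} [NormedAddCommGroup H] [InnerProductSpace ℂ H] [CompleteSpace H]
    (hdim : 3 ≤ Module.rank ℂ H)
    (φ : EffectAlgebra.effects H → EffectAlgebra.effects H)
    (hbij : Function.Bijective φ)
    (horder : ∀ A B : EffectAlgebra.effects H, A ≤ B ↔ φ A ≤ φ B)
    (hortho : ∀ A : EffectAlgebra.effects H,
      φ (EffectAlgebra.orthocomplement A) = EffectAlgebra.orthocomplement (φ A)) :
    (∃ U : H →L[ℂ] H, U ∈ unitary (H →L[ℂ] H) ∧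
      ∀ A : EffectAlgebra.effects H,
        (φ A : H →L[ℂ] H) = U.comp ((A : H →L[ℂ] H).comp (ContinuousLinearMap.adjoint U))) ∨
    (∃ U : H →L⋆[ℂ] H, EffectAlgebra.IsAntiunitary U ∧
      ∀ A : EffectAlgebra.effects H,
        (φ A : H →L[ℂ] H) =
          U.comp ((A : H →L[ℂ] H).comp (EffectAlgebra.conjAdjoint U))) := by
  open EffectAlgebra in
  let e : effects H ≃o effects H :=
    OrderIso.ofSurjective (OrderEmbedding.ofMapLEIff φ fun A B => (horder A B).symm) hbij.2
  obtain ⟨U, hsurj, hquad, hlin | hconj⟩ := exists_implementing_map hdim e hortho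
  · left
    have hnorm : ∀ x, ‖U x‖ = ‖x‖ := fun x => norm_eq_of_inner_self_eq (hlin x x)
    let V : H →L[ℂ] H := LinearMap.mkContinuous
      { toFun := U
        map_add' := map_add_of_re_inner fun x y => by rw [hlin]
        map_smul' := map_smul_of_inner hlin } 1 fun x => by
          rw [one_mul]
          exact (hnorm x).le
    have hVV : ContinuousLinearMap.adjoint V ∘L V = 1 :=
      (ContinuousLinearMap.inner_map_map_iff_adjoint_comp_self V).1 hlin
    have hV : ∀ w, ContinuousLinearMap.adjoint V (U w) = w := fun w => congrArg (· w) hVV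
    refine ⟨V, Unitary.mem_iff.2 ⟨hVV, ?_⟩, fun A => coe_eq_of_inner_apply_self hsurj fun w => ?_⟩
    · ext z
      obtain ⟨w, rfl⟩ := hsurj z
      exact congrArg U (hV w)
    · change inner ℂ (U (A.1 (ContinuousLinearMap.adjoint V (U w)))) (U w) = _
      rw [hV, hlin, inner_apply_self]
      exact congrArg _ (hquad A w).symm
  · right
    have hnorm : ∀ x, ‖U x‖ = ‖x‖ := fun x => norm_eq_of_inner_self_eq (hconj x x)
    let V : H →L⋆[ℂ] H := LinearMap.mkContinuous
      { toFun := U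
        map_add' := map_add_of_re_inner fun x y => by
          rw [hconj, ← inner_conj_symm, Complex.conj_re]
        map_smul' := map_smul_of_inner_swap hconj } 1 fun x => by
          rw [one_mul]
          exact (hnorm x).le
    have hV : ∀ w, conjAdjoint V (U w) = w := fun w => by
      refine ext_inner_right ℂ fun x => ?_
      rw [inner_conjAdjoint_left]
      exact hconj x w
    have hinj : Function.Injective U := fun x y hxy => by rw [← hV x, hxy, hV]
    refine ⟨V, ⟨⟨hinj, hsurj⟩, hconj⟩, fun A => coe_eq_of_inner_apply_self hsurj fun w => ?_⟩
    change inner ℂ (U (A.1 (conjAdjoint V (U w)))) (U w) = _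
    rw [hV, hconj, inner_apply_right, inner_apply_self]
    exact congrArg _ (hquad A w).symm
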